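/- For a finite simple graph $G$ let $I(G,x)=\sum_{j\ge 0} s(G,j)x^j$ be its independence polynomial, where $s(G,j)$ is the number of independent sets of $G$ with exactly $j$ vertices, and let $\xi(G)$ denote the largest real root of $I(G,x)$. For integers $n_1,\dots,n_k\ge 2$ let $T(n_1,\dots,n_k)$ be the tree obtained from disjoint paths on $n_1-1,\dots,n_k-1$ vertices by adding one new vertex and joining it to one end vertex of each path. For non-increasing $k$-tuples, write $(n_1,\dots,n_k)\succeq_d(m_1,\dots,m_k)$ if $\sum_{i=1}^{j} n_i\ge\sum_{i=1}^{j} m_i$ for every $j=1,\dots,k$. Let $n_1\ge\cdots\ge n_k\ge 2$ and $m_1\ge\cdots\ge m_k\ge 2$ be integers, and let $T_1=T(n_1,\dots,n_k)$ and $T_2=T(m_1,\dots,m_k)$ be of the same order and of maximum degree $k$. If $(n_1,\dots,n_k)\succeq_d(m_1,\dots,m_k)$, then $I(T_1,x)$ and $I(T_2,x)$ have real roots, their largest real roots $\xi(T_1)$ and $\xi(T_2)$ exist, and $\xi(T_2)\ge\xi(T_1)$. -/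

import Mathlib

/-- The independence polynomial `I(G, x) = ∑ₖ s(G, k) xᵏ` of a finite simple graph, where
`s(G, k)` is the number of independent sets of `G` with exactly `k` vertices. -/
noncomputable def independencePolynomial {V : Type*} [Fintype V] (G : SimpleGraph V) :
    Polynomial ℝ :=
  open Classical in
  ∑ k ∈ Finset.range (Fintype.card V + 1),
    Polynomial.monomial k ((G.indepSetFinset k).card : ℝ)

/-- The set of real roots of the independence polynomial of `G`. -/
def independenceRoots {V : Type*} [Fintype V] (G : SimpleGraph V) : Set ℝ :=
  {x : ℝ | (independencePolynomial G).IsRoot x}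

/-- `ξ(G)`, the largest real root of the independence polynomial of `G` (written as a supremum;
it is the largest root when `IsGreatest (independenceRoots G) (xi G)` holds). -/
noncomputable def xi {V : Type*} [Fintype V] (G : SimpleGraph V) : ℝ :=
  sSup (independenceRoots G)

/-- The vertices of `T(n₁, …, n_k)`: the centre `none` and, for each `i`, the `n_i - 1` vertices
`some ⟨i, 0⟩, some ⟨i, 1⟩, …` of the `i`-th arm, listed outwards from the centre. -/
abbrev StarlikeVertex {k : ℕ} (n : Fin k → ℕ) : Type :=
  Option (Σ i : Fin k, Fin (n i - 1))

/-- The edges of `T(n₁, …, n_k)`, each oriented away from the centre. -/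
inductive StarlikeEdge {k : ℕ} (n : Fin k → ℕ) : StarlikeVertex n → StarlikeVertex n → Prop
  | centre (i : Fin k) (a : Fin (n i - 1)) (ha : (a : ℕ) = 0) :
      StarlikeEdge n none (some ⟨i, a⟩)
  | arm (i : Fin k) (a b : Fin (n i - 1)) (hab : (a : ℕ) + 1 = b) :
      StarlikeEdge n (some ⟨i, a⟩) (some ⟨i, b⟩)

/-- The tree `T(n₁, …, n_k)`: a centre joined to one end vertex of each of the disjoint paths
`P_{n₁ - 1}, …, P_{n_k - 1}`. -/
def starlikeTree {k : ℕ} (n : Fin k → ℕ) : SimpleGraph (StarlikeVertex n) :=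
  SimpleGraph.fromRel (StarlikeEdge n)

/-- The dominance order `(x₁, …, x_k) ⪰_d (y₁, …, y_k)`: every partial sum `x₁ + ⋯ + x_j` is at
least `y₁ + ⋯ + y_j`. It is used for non-increasing tuples. -/
def Dominates {k : ℕ} (x y : Fin k → ℕ) : Prop :=
  ∀ j : Fin k, ∑ i ∈ Finset.Iic j, y i ≤ ∑ i ∈ Finset.Iic j, x i

/-! Put x = -t and f_j = `armValue t j`. Splitting on whether the centre is chosen gives
I(T(n_1,…,n_k), -t) = ∏ f_{n_i+1} - t ∏ f_{n_i}. This is positive for t ≤ 0, so the largest root is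
minus the least positive zero in t. It therefore suffices that positivity on [0, t] passes from T_2
to T_1.

Dominance between tuples of equal sum is generated by moving one unit from an entry to another at
least as large (`dominance_induction`). By the Cassini identity such a move changes the value by t^b
f_{d+1} (∏ f_{m_l} - ∏ f_{m_l+1}), where b is the source entry before the move, d is the difference
of the two entries, and the products run over the untouched arms (`starlikeValue_le_transfer`). This
is nonnegative once the f's involved are positive, which positivity of the tree's own value on [0,
t] ensures (`armValue_pos_of_starlikeValue_pos`). -/

/-! ### Path polynomials -/

/-- The path polynomials at `-t`: `armValue t (j + 2)` is `I(P_j, -t)`. -/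
noncomputable def armValue (t : ℝ) : ℕ → ℝ
  | 0 => 0
  | 1 => 1
  | j + 2 => armValue t (j + 1) - t * armValue t j

theorem armValue_add_two (t : ℝ) (j : ℕ) :
    armValue t (j + 2) = armValue t (j + 1) - t * armValue t j := rfl

theorem continuous_armValue (j : ℕ) : Continuous fun t => armValue t j := by
  induction j using Nat.twoStepInduction with
  | zero => exact continuous_const
  | one => exact continuous_const
  | more j h₀ h₁ => exact h₁.sub (continuous_id.mul h₀)

theorem armValue_pos_of_nonpos {t : ℝ} (ht : t ≤ 0) (j : ℕ) : 0 < armValue t (j + 1) := by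
  suffices h : 0 ≤ armValue t j ∧ 0 < armValue t (j + 1) from h.2
  induction j with
  | zero => exact ⟨le_rfl, one_pos⟩
  | succ j ih =>
    refine ⟨ih.2.le, ?_⟩
    rw [armValue_add_two]
    nlinarith [mul_nonneg (neg_nonneg.2 ht) ih.1, ih.2]

/-- The Cassini-type identity for the path polynomials. -/
theorem armValue_cassini (t : ℝ) (d b : ℕ) :
    armValue t (b + d + 1) * armValue t (b + 1) - armValue t (b + d + 2) * armValue t b =
      t ^ b * armValue t (d + 1) := by
  induction b with
  | zero => simp [armValue]
  | succ b ih =>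
    have h₁ : armValue t (b + 1 + 1) = armValue t (b + 1) - t * armValue t b := rfl
    have h₂ : armValue t (b + 1 + d + 2) = armValue t (b + d + 2) - t * armValue t (b + d + 1) := by
      rw [show b + 1 + d + 2 = (b + d + 1) + 2 by ring, armValue_add_two]
    rw [h₁, h₂, show b + 1 + d + 1 = b + d + 2 by ring, pow_succ]
    linear_combination t * ih

/-! ### Values of starlike trees and the unit transfer -/

/-- The value at `-t` of the independence polynomial of the starlike tree with arms indexed
by `I`. -/
noncomputable def starlikeValue {ι : Type*} (I : Finset ι) (m : ι → ℕ) (t : ℝ) : ℝ :=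
  ∏ i ∈ I, armValue t (m i + 1) - t * ∏ i ∈ I, armValue t (m i)

theorem continuous_starlikeValue {ι : Type*} (I : Finset ι) (m : ι → ℕ) :
    Continuous (starlikeValue I m) :=
  (continuous_finsetProd _ fun i _ => continuous_armValue (m i + 1)).sub
    (continuous_id.mul (continuous_finsetProd _ fun i _ => continuous_armValue (m i)))

theorem starlikeValue_pos_of_nonpos {ι : Type*} (I : Finset ι) {m : ι → ℕ}
    (hm : ∀ i ∈ I, 0 < m i) {t : ℝ} (ht : t ≤ 0) : 0 < starlikeValue I m t := by
  have h₁ : 0 < ∏ i ∈ I, armValue t (m i + 1) :=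
    Finset.prod_pos fun i _ => armValue_pos_of_nonpos ht _
  have h₂ : 0 ≤ ∏ i ∈ I, armValue t (m i) := Finset.prod_nonneg fun i hi => by
    obtain ⟨a, ha⟩ := Nat.exists_eq_succ_of_ne_zero (hm i hi).ne'
    rw [ha]
    exact (armValue_pos_of_nonpos ht a).le
  unfold starlikeValue
  nlinarith [mul_nonneg (neg_nonneg.2 ht) h₂]

/-- If a starlike tree has no root in `[-t, 0]`, neither has any path contained in an arm. -/
theorem armValue_pos_of_starlikeValue_pos {ι : Type*} {I : Finset ι} {m : ι → ℕ} {t : ℝ}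
    (h : ∀ u ∈ Set.Icc 0 t, 0 < starlikeValue I m u) :
    ∀ u ∈ Set.Icc 0 t, ∀ i ∈ I, ∀ j ≤ m i, 0 < armValue u (j + 1) := by
  by_contra! hbad
  obtain ⟨u, hu, i, hi, j, hj, huj⟩ := hbad
  -- The least element of this compact set is the first parameter at which some path polynomial
  -- stops being positive.
  let S : Set ℝ := ⋃ i ∈ (I : Set ι), ⋃ j ∈ Set.Iic (m i), {u ∈ Set.Icc 0 t | armValue u (j + 1) ≤ 0}
  have hS : IsCompact S :=
    I.finite_toSet.isCompact_biUnion fun i _ => (Set.finite_Iic (m i)).isCompact_biUnion fun j _ =>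
      isCompact_Icc.inter_right (isClosed_le (continuous_armValue (j + 1)) continuous_const)
  have memS (v : ℝ) : v ∈ S ↔ ∃ i ∈ I, ∃ j ≤ m i, v ∈ Set.Icc 0 t ∧ armValue v (j + 1) ≤ 0 := by
    simp only [S, Set.mem_iUnion, Finset.mem_coe, Set.mem_Iic, Set.mem_ofPred_eq, exists_prop]
  obtain ⟨v, hvS, hvmin⟩ := hS.exists_isLeast ⟨u, (memS u).2 ⟨i, hi, j, hj, hu, huj⟩⟩
  obtain ⟨i₀, hi₀, j₀, hj₀, hv, hvj⟩ := (memS v).1 hvS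
  have nonneg : ∀ i ∈ I, ∀ j ≤ m i, 0 ≤ armValue v (j + 1) := by
    intro i hi j hj
    by_contra! hneg
    obtain ⟨w, hw, hw0⟩ := intermediate_value_Icc' hv.1 (continuous_armValue (j + 1)).continuousOn
      ⟨hneg.le, (armValue_pos_of_nonpos le_rfl j).le⟩
    have hwv : v ≤ w := hvmin ((memS w).2 ⟨i, hi, j, hj, ⟨hw.1, hw.2.trans hv.2⟩, hw0.le⟩)
    rw [le_antisymm hw.2 hwv] at hw0
    exact hneg.ne hw0
  have nonneg' : ∀ i ∈ I, ∀ j ≤ m i + 1, 0 ≤ armValue v j := by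
    rintro i hi (_ | j) hj
    · exact le_rfl
    · exact nonneg i hi j (by omega)
  -- As f_{j+2} = f_{j+1} - v f_j with f_j ≥ 0, nonpositivity spreads to the end of the arm. There
  -- it kills the first product and leaves a value ≤ 0.
  have hzero : ∀ j, j₀ ≤ j → j ≤ m i₀ → armValue v (j + 1) ≤ 0 := by
    intro j hj
    induction j, hj using Nat.le_induction with
    | base => exact fun _ => hvj
    | succ j _ ih =>
      intro hj
      rw [armValue_add_two]
      have := mul_nonneg hv.1 (nonneg' i₀ hi₀ j (by omega))
      linarith [ih (by omega)]
  have hprod : ∏ i ∈ I, armValue v (m i + 1) = 0 :=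
    Finset.prod_eq_zero hi₀ (le_antisymm (hzero _ hj₀ le_rfl) (nonneg i₀ hi₀ _ le_rfl))
  have hprod' : 0 ≤ ∏ i ∈ I, armValue v (m i) :=
    Finset.prod_nonneg fun i hi => nonneg' i hi _ (by omega)
  have := h v hv
  rw [starlikeValue, hprod] at this
  linarith [mul_nonneg hv.1 hprod']

/-- Moving a vertex from an arm to one at least as long does not decrease the value. -/
theorem starlikeValue_le_transfer {ι : Type*} [DecidableEq ι] {I : Finset ι} {m m' : ι → ℕ} {t : ℝ}
    (ht : 0 ≤ t) (hpos : ∀ i ∈ I, ∀ j ≤ m i, 0 < armValue t (j + 1))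
    {i j : ι} (hi : i ∈ I) (hj : j ∈ I) (hij : i ≠ j) (hle : m j ≤ m i)
    (hm : ∀ l ∈ I, 0 < m l) (hi' : m' i = m i + 1) (hj' : m' j + 1 = m j) (hrest : ∀ l, l ≠ i → l ≠ j → m' l = m l) :
    starlikeValue I m t ≤ starlikeValue I m' t := by
  have split (f : ι → ℝ) : ∏ l ∈ I, f l = f i * (f j * ∏ l ∈ (I.erase i).erase j, f l) := by
    rw [← Finset.mul_prod_erase I f hi,
      ← Finset.mul_prod_erase (I.erase i) f (Finset.mem_erase.2 ⟨hij.symm, hj⟩)]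
  have hcongr (c : ℕ) : ∏ l ∈ (I.erase i).erase j, armValue t (m' l + c) =
      ∏ l ∈ (I.erase i).erase j, armValue t (m l + c) := by
    refine Finset.prod_congr rfl fun l hl => ?_
    simp only [Finset.mem_erase] at hl
    rw [hrest l hl.2.1 hl.1]
  have hnonneg : ∀ l ∈ I, ∀ c ≤ m l + 1, 0 ≤ armValue t c := by
    rintro l hl (_ | c) hc
    · exact le_rfl
    · exact (hpos l hl c (by omega)).le
  have hprod : ∏ l ∈ (I.erase i).erase j, armValue t (m l + 1) ≤
      ∏ l ∈ (I.erase i).erase j, armValue t (m l + 0) := by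
    refine Finset.prod_le_prod (fun l hl => ?_) fun l hl => ?_
    all_goals have hl' : l ∈ I := Finset.mem_of_mem_erase (Finset.mem_of_mem_erase hl)
    · exact hnonneg l hl' _ le_rfl
    · rcases hml : m l with _ | c
      · exact absurd (hm l hl') (by omega)
      · rw [armValue_add_two]
        linarith [mul_nonneg ht (hnonneg l hl' c (by omega))]
  obtain ⟨d, hd⟩ := Nat.exists_eq_add_of_le hle
  -- With b = `m' j`, the first product changes by a t^(b+1) term and the second by a t^b term; the
  -- factor t in front of the second equalises the powers.
  have c₁ := armValue_cassini t d (m' j + 1)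
  have c₂ := armValue_cassini t d (m' j)
  have hd' : m i = m' j + 1 + d := by omega
  have hs : 0 ≤ armValue t (d + 1) := hnonneg i hi _ (by omega)
  have h₀ := hcongr 0
  have h₁ := hcongr 1
  simp only [add_zero] at h₀ hprod
  unfold starlikeValue
  simp only [split fun l => armValue t (m l + 1), split fun l => armValue t (m l),
    split fun l => armValue t (m' l + 1), split fun l => armValue t (m' l), h₀, h₁, hi', ← hj', hd']
  rw [show m' j + d + 1 = m' j + 1 + d by ring, show m' j + d + 2 = m' j + 1 + d + 1 by ring] at c₂
  have key := mul_nonneg (mul_nonneg (pow_nonneg ht (m' j + 1)) hs) (sub_nonneg.2 hprod)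
  set R := ∏ l ∈ (I.erase i).erase j, armValue t (m l + 1)
  set R' := ∏ l ∈ (I.erase i).erase j, armValue t (m l)
  have e : t ^ (m' j + 1) * armValue t (d + 1) * (R' - R) =
      t * R' * (t ^ (m' j) * armValue t (d + 1)) - R * (t ^ (m' j + 1) * armValue t (d + 1)) := by
    ring
  rw [e, ← c₁, ← c₂] at key
  linarith

/-! ### Dominance as a chain of unit transfers -/

/-- Domination between non-increasing sequences of equal sum is generated by moving one unit
from a smaller (or equal) entry to a larger one. -/
theorem dominance_induction {k : ℕ} {n : ℕ → ℕ} (hn : Antitone n) {P : (ℕ → ℕ) → Prop}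
    (step : ∀ m m' : ℕ → ℕ, ∀ i j, i < j → j < k → m j ≤ m i → m' i = m i + 1 → m' j + 1 = m j →
      n j < m j → (∀ l, l ≠ i → l ≠ j → m' l = m l) → P m → P m') :
    ∀ m : ℕ → ℕ, Antitone m → (∀ l, ∑ i ∈ Finset.range l, m i ≤ ∑ i ∈ Finset.range l, n i) →
      (∀ l, k ≤ l → ∑ i ∈ Finset.range l, m i = ∑ i ∈ Finset.range l, n i) → P m → P n := by
  suffices H : ∀ r, ∀ m : ℕ → ℕ, Antitone m →
      (∀ l, ∑ i ∈ Finset.range l, m i ≤ ∑ i ∈ Finset.range l, n i) →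
      (∀ l, k ≤ l → ∑ i ∈ Finset.range l, m i = ∑ i ∈ Finset.range l, n i) →
      -- The induction is on the total gap between partial sums, which every transfer lowers.
      ∑ l ∈ Finset.range k, (∑ i ∈ Finset.range l, n i - ∑ i ∈ Finset.range l, m i) = r →
      P m → P n from fun m h₁ h₂ h₃ => H _ m h₁ h₂ h₃ rfl
  intro r
  induction r using Nat.strong_induction_on with
  | _ r ih =>
  intro m hm hdom heq hr hP
  by_cases hall : ∀ l, ∑ i ∈ Finset.range l, m i = ∑ i ∈ Finset.range l, n i
  · have : m = n := funext fun l => by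
      have h₁ := hall l
      have h₂ := hall (l + 1)
      rw [Finset.sum_range_succ, Finset.sum_range_succ] at h₂
      omega
    exact this ▸ hP
  push Not at hall
  set A : ℕ → ℕ := fun l => ∑ i ∈ Finset.range l, m i with hA
  set B : ℕ → ℕ := fun l => ∑ i ∈ Finset.range l, n i with hB
  have A_succ (l) : A (l + 1) = A l + m l := Finset.sum_range_succ ..
  have B_succ (l) : B (l + 1) = B l + n l := Finset.sum_range_succ ..
  change ∀ l, A l ≤ B l at hdom
  change ∀ l, k ≤ l → A l = B l at heq
  change ∃ l, A l ≠ B l at hall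
  -- The partial sums agree up to `i`, differ strictly at `i + 1`, …, `j`, and agree again at `j +
  -- 1`. Moving a unit from `j` to `i` raises exactly those strict sums by one.
  obtain ⟨i, hi, hi'⟩ : ∃ i, A i = B i ∧ A (i + 1) < B (i + 1) := by
    classical
    obtain ⟨i, hi⟩ : ∃ i, Nat.find hall = i + 1 :=
      Nat.exists_eq_succ_of_ne_zero fun h => Nat.find_spec hall (by rw [h]; rfl)
    have h₁ := Nat.find_spec hall
    have h₂ := Nat.find_min hall (m := i) (by omega)
    rw [hi] at h₁
    exact ⟨i, not_not.1 h₂, lt_of_le_of_ne (hdom _) h₁⟩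
  obtain ⟨j, hij, hj, hmid⟩ : ∃ j, i < j ∧ A (j + 1) = B (j + 1) ∧
      ∀ l, i < l → l ≤ j → A l < B l := by
    classical
    have hex : ∃ l, i < l ∧ A l = B l := ⟨max (i + 1) k, by omega, heq _ (by omega)⟩
    obtain ⟨j, hj⟩ : ∃ j, Nat.find hex = j + 1 :=
      Nat.exists_eq_succ_of_ne_zero fun h => by have := (Nat.find_spec hex).1; omega
    have h₁ := Nat.find_spec hex
    rw [hj] at h₁
    refine ⟨j, ?_, h₁.2, fun l hl hlj => ?_⟩
    · by_contra! h
      have : j = i := by omega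
      rw [this] at h₁
      omega
    · have h₂ := Nat.find_min hex (m := l) (by omega)
      exact lt_of_le_of_ne (hdom l) fun h => h₂ ⟨hl, h⟩
  have hjj := hmid j hij le_rfl
  have hjk : j < k := by
    by_contra! h
    exact hjj.ne (heq j h)
  have hnj : n j < m j := by have := A_succ j; have := B_succ j; omega
  set m' : ℕ → ℕ := fun l => if l = i then m i + 1 else if l = j then m j - 1 else m l with hm'
  have m'i : m' i = m i + 1 := by simp [hm']
  have m'j : m' j = m j - 1 := by simp [hm', hij.ne']
  have m'l (l) (h : l ≠ i) (h' : l ≠ j) : m' l = m l := by simp [hm', h, h']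
  have sum' (l) : ∑ x ∈ Finset.range l, m' x = A l + if i < l ∧ l ≤ j then 1 else 0 := by
    induction l with
    | zero => simp [hA]
    | succ l ihl =>
      rw [Finset.sum_range_succ, ihl, A_succ]
      rcases eq_or_ne l i with rfl | h
      · rw [m'i, if_neg (by omega), if_pos (by omega)]; omega
      rcases eq_or_ne l j with rfl | h'
      · rw [m'j, if_pos (by omega), if_neg (by omega)]; omega
      · rw [m'l l h h']
        have : (i < l ∧ l ≤ j) ↔ (i < l + 1 ∧ l + 1 ≤ j) := by omega
        simp only [this]
        omega
  refine ih _ ?_ m' ?_ ?_ ?_ rfl ?_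
  · rw [← hr]
    refine Finset.sum_lt_sum (fun l _ => ?_) ⟨j, Finset.mem_range.2 hjk, ?_⟩
    · rw [sum']; exact Nat.sub_le_sub_left (Nat.le_add_right _ _) _
    · rw [sum', if_pos ⟨hij, le_rfl⟩]
      change B j - (A j + 1) < B j - A j
      omega
  -- Monotonicity could fail only just before `i` or just after `j`. There m_{i-1} ≥ n_{i-1} ≥ n_i >
  -- m_i and m_j > n_j ≥ n_{j+1} ≥ m_{j+1} leave room for the unit.
  · refine antitone_nat_of_succ_le fun l => ?_
    have a₀ := A_succ l
    have a₁ := A_succ (l + 1)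
    have b₀ := B_succ l
    have b₁ := B_succ (l + 1)
    have d₀ := hdom l
    have d₂ := hdom (l + 1 + 1)
    have n₀ := hn (Nat.le_succ l)
    have m₀ := hm (Nat.le_succ l)
    simp only [Nat.succ_eq_add_one] at n₀ m₀
    rcases eq_or_ne l i with rfl | h
    · rcases eq_or_ne (l + 1) j with rfl | h'
      · rw [m'i, m'j]; omega
      · rw [m'i, m'l _ (by omega) h']; omega
    rcases eq_or_ne l j with rfl | h'
    · rw [m'j, m'l _ (by omega) (by omega)]; omega
    rw [m'l l h h']
    rcases eq_or_ne (l + 1) i with rfl | h₂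
    · rw [m'i]; omega
    rcases eq_or_ne (l + 1) j with rfl | h₃
    · rw [m'j]; omega
    · rw [m'l _ h₂ h₃]; omega
  · intro l
    rw [sum']
    change _ ≤ B l
    split_ifs with h
    · exact hmid l h.1 h.2
    · exact hdom l
  · intro l hl
    rw [sum', if_neg (by omega)]
    exact heq l hl
  · exact step m m' i j hij hjk (hm hij.le) m'i (by omega) hnj m'l hP

theorem starlikeValue_pos_of_dominates {k : ℕ} {n m : ℕ → ℕ} (hn : Antitone n) (hm : Antitone m)
    (hnpos : ∀ i < k, 0 < n i) (hmpos : ∀ i < k, 0 < m i)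
    (hdom : ∀ l, ∑ i ∈ Finset.range l, m i ≤ ∑ i ∈ Finset.range l, n i)
    (heq : ∀ l, k ≤ l → ∑ i ∈ Finset.range l, m i = ∑ i ∈ Finset.range l, n i) {t : ℝ}
    (h : ∀ u ∈ Set.Icc 0 t, 0 < starlikeValue (Finset.range k) m u) :
    ∀ u ∈ Set.Icc 0 t, 0 < starlikeValue (Finset.range k) n u := by
  refine (dominance_induction (k := k) hn (P := fun m => (∀ i < k, 0 < m i) ∧
    ∀ u ∈ Set.Icc 0 t, 0 < starlikeValue (Finset.range k) m u) ?_ m hm hdom heq ⟨hmpos, h⟩).2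
  rintro m m' i j hij hjk hle hi' hj' hnj hrest ⟨hpos, h⟩
  refine ⟨fun l hl => ?_, fun u hu => (h u hu).trans_le ?_⟩
  · rcases eq_or_ne l i with rfl | h₁
    · omega
    rcases eq_or_ne l j with rfl | h₂
    -- The donor exceeds its target `n j` before the move, so it stays positive after it.
    · have := hnpos l hl
      omega
    · rw [hrest l h₁ h₂]
      exact hpos l hl
  · exact starlikeValue_le_transfer hu.1 (armValue_pos_of_starlikeValue_pos h u hu)
      (Finset.mem_range.2 (hij.trans hjk)) (Finset.mem_range.2 hjk) hij.ne hle
      (fun l hl => hpos l (Finset.mem_range.1 hl)) hi' hj' hrest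

/-- An arm with entry at least 2 contains a single vertex, whose polynomial 1 - t vanishes at t = 1;
hence the tree cannot stay positive on [0, 1]. With no arms the value is itself 1 - t. -/
theorem exists_starlikeValue_eq_zero {ι : Type*} (I : Finset ι) {m : ι → ℕ}
    (hm : ∀ i ∈ I, 2 ≤ m i) : ∃ t, starlikeValue I m t = 0 := by
  by_contra! hne
  have hpos : ∀ u ∈ Set.Icc (0 : ℝ) 1, 0 < starlikeValue I m u := by
    intro u hu
    by_contra! hneg
    obtain ⟨w, -, hw⟩ := intermediate_value_Icc' hu.1 (continuous_starlikeValue I m).continuousOn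
      ⟨hneg, (starlikeValue_pos_of_nonpos I (fun i hi => by have := hm i hi; omega) le_rfl).le⟩
    exact hne w hw
  rcases I.eq_empty_or_nonempty with rfl | ⟨i, hi⟩
  · exact hne 1 (by simp [starlikeValue])
  · have := armValue_pos_of_starlikeValue_pos hpos 1 (by simp) i hi 2 (hm i hi)
    norm_num [armValue] at this

/-! ### Independence polynomials of paths and starlike trees -/

theorem independencePolynomial_eval_eq_sum_finset {V : Type*} [Fintype V] (G : SimpleGraph V)
    (x : ℝ) : open Classical in (independencePolynomial G).eval x =
      ∑ S : Finset V, if G.IsIndepSet S then x ^ S.card else 0 := by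
  classical
  rw [← Finset.sum_fiberwise_of_maps_to (s := Finset.univ)
    (t := Finset.range (Fintype.card V + 1)) (g := Finset.card)
    fun S _ => Finset.mem_range.2 (Nat.lt_succ_of_le S.card_le_univ)]
  simp only [independencePolynomial, Polynomial.eval_finsetSum, Polynomial.eval_monomial]
  refine Finset.sum_congr rfl fun k _ => ?_
  rw [← Finset.sum_filter, Finset.filter_filter, ← nsmul_eq_mul, ← Finset.sum_const]
  refine Finset.sum_congr (Finset.ext fun S => ?_) fun S hS => ?_
  · simp [SimpleGraph.isNIndepSet_iff, and_comm]
  · rw [(Finset.mem_filter.1 hS).2.1]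

/-- The independence polynomial as a sum over indicator functions of sets of vertices. -/
theorem independencePolynomial_eval {V : Type*} [Fintype V] [DecidableEq V] (G : SimpleGraph V) (x : ℝ) :
    open Classical in (independencePolynomial G).eval x =
      ∑ c : V → Bool, if ∀ u v, G.Adj u v → ¬(c u = true ∧ c v = true) then
        ∏ v, (if c v then x else 1) else 0 := by
  classical
  rw [independencePolynomial_eval_eq_sum_finset]
  refine Fintype.sum_equiv
    ⟨fun S v => decide (v ∈ S), fun c => Finset.univ.filter fun v => c v = true,
      fun S => by ext; simp, fun c => by ext; simp⟩ _ _ fun S => ?_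
  have h : G.IsIndepSet S ↔ ∀ u v, G.Adj u v → ¬(u ∈ S ∧ v ∈ S) := by
    refine ⟨fun h u v huv huS => h huS.1 huS.2 huv.ne huv, fun h u hu v hv _ huv => h u v huv ⟨hu, hv⟩⟩
  simp [h, Finset.prod_const]

theorem independencePolynomial_eval_congr {V W : Type*} [Fintype V] [Fintype W]
    {G : SimpleGraph V} {H : SimpleGraph W} (e : G ≃g H) (x : ℝ) :
    (independencePolynomial G).eval x = (independencePolynomial H).eval x := by
  classical
  rw [independencePolynomial_eval, independencePolynomial_eval]
  refine Fintype.sum_equiv (e.toEquiv.arrowCongr (Equiv.refl Bool)) _ _ fun c => ?_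
  have h : (∀ u v, G.Adj u v → ¬(c u = true ∧ c v = true)) ↔
      ∀ u v, H.Adj u v → ¬(c (e.symm u) = true ∧ c (e.symm v) = true) := by
    refine ⟨fun h u v huv => h _ _ (e.symm.map_adj_iff.2 huv), fun h u v huv => ?_⟩
    simpa using h (e u) (e v) (e.map_adj_iff.2 huv)
  have h' : ∏ v, (if c v then x else 1) = ∏ v, (if c (e.symm v) then x else 1) :=
    Fintype.prod_equiv e.toEquiv _ _ fun v => by
      change _ = if c (e.symm (e v)) = true then x else 1
      rw [e.symm_apply_apply]
  rw [h']
  exact if_congr h rfl rfl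

/-- Independence of a set of vertices of a path, where the first vertex is forbidden if `b`. -/
def PathIndependent (b : Bool) {r : ℕ} (c : Fin r → Bool) : Prop :=
  (∀ u v : Fin r, (u : ℕ) + 1 = v → ¬(c u = true ∧ c v = true)) ∧
    (b = true → ∀ u : Fin r, (u : ℕ) = 0 → c u = false)

theorem pathIndependent_cons {b b' : Bool} {r : ℕ} {c : Fin r → Bool} :
    PathIndependent b (Fin.cons b' c : Fin (r + 1) → Bool) ↔
      (b = true → b' = false) ∧ PathIndependent b' c := by
  unfold PathIndependent
  constructor
  · rintro ⟨h, hb⟩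
    refine ⟨fun h' => by simpa using hb h' 0 rfl, fun u v huv => ?_, fun h' u hu => ?_⟩
    · simpa using h u.succ v.succ (by simp [huv])
    · simpa [h'] using h 0 u.succ (by simp [hu])
  · rintro ⟨h₁, h, h'⟩
    refine ⟨fun u v huv => ?_, fun hb u hu => ?_⟩
    · cases v using Fin.cases with
      | zero => simp at huv
      | succ v =>
        cases u using Fin.cases with
        | zero =>
          rintro ⟨hb, hv⟩
          have hv0 : (v : ℕ) = 0 := by simpa using huv.symm
          simp [h' (by simpa using hb) v hv0] at hv
        | succ u => simpa using h u v (by simpa using huv)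
    · obtain rfl : u = 0 := Fin.ext hu
      simpa using h₁ hb

/-- Both sums are needed together: fixing the first vertex leaves a shorter path whose new first
vertex is forbidden exactly when the fixed one was chosen. -/
theorem sum_pathIndependent (x : ℝ) (r : ℕ) : open Classical in
    (∑ c : Fin r → Bool, if PathIndependent false c then ∏ u, (if c u then x else 1) else 0) =
        armValue (-x) (r + 2) ∧
      (∑ c : Fin r → Bool, if PathIndependent true c then ∏ u, (if c u then x else 1) else 0) =
        armValue (-x) (r + 1) := by
  classical
  induction r with
  | zero => constructor <;> simp [PathIndependent, armValue]
  | succ r ih =>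
    have key (b : Bool) : (∑ c : Fin (r + 1) → Bool,
        if PathIndependent b c then ∏ u, (if c u then x else 1) else 0) =
        ∑ b' : Bool, if b = true → b' = false then (if b' then x else 1) *
          ∑ c : Fin r → Bool, if PathIndependent b' c then ∏ u, (if c u then x else 1) else 0
          else 0 := by
      rw [← (Fin.consEquiv fun _ => Bool).sum_comp, Fintype.sum_prod_type]
      refine Finset.sum_congr rfl fun b' _ => ?_
      have hc (c : Fin r → Bool) : PathIndependent b (Fin.consEquiv (fun _ => Bool) (b', c)) ↔
          (b = true → b' = false) ∧ PathIndependent b' c := pathIndependent_cons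
      simp only [hc, Fin.consEquiv_apply, Fin.prod_univ_succ, Fin.cons_zero,
        Fin.cons_succ, Finset.mul_sum, mul_ite, mul_zero]
      by_cases h : b = true → b' = false
      · rw [if_pos h]
        exact Finset.sum_congr rfl fun c _ => if_congr (and_iff_right h) rfl rfl
      · simp [h]
    rw [key, key, Fintype.sum_bool, Fintype.sum_bool, ih.1, ih.2]
    constructor <;> simp [armValue_add_two (-x) (r + 1)]
    ring

theorem starlikeTree_independent_iff {k : ℕ} {n : Fin k → ℕ} (c : StarlikeVertex n → Bool) :
    (∀ u v, (starlikeTree n).Adj u v → ¬(c u = true ∧ c v = true)) ↔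
      ∀ i, PathIndependent (c none) fun a => c (some ⟨i, a⟩) := by
  constructor
  · refine fun h i => ⟨fun u v huv => h _ _ ?_, fun hb u hu => ?_⟩
    · refine ⟨fun h => ?_, Or.inl (.arm i u v huv)⟩
      simp only [Option.some.injEq, Sigma.mk.injEq, heq_eq_eq, true_and] at h
      rw [h] at huv
      omega
    · simpa [hb] using h none (some ⟨i, u⟩) ⟨by simp, Or.inl (.centre i u hu)⟩
  · intro h
    have hE (u v) (huv : StarlikeEdge n u v) : ¬(c u = true ∧ c v = true) := by
      cases huv with
      | centre i a ha => exact fun hc => by simp [(h i).2 hc.1 a ha] at hc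
      | arm i a b hab => exact (h i).1 a b hab
    rintro u v ⟨-, huv | huv⟩
    · exact hE u v huv
    · exact fun hc => hE v u huv hc.symm

/-- Once the state of the centre is fixed the arms are independent, so the sum factors. A chosen
centre contributes `x` and forbids the first vertex of each arm. -/
theorem independencePolynomial_starlikeTree_eval {k : ℕ} {n : Fin k → ℕ} (hn : ∀ i, 0 < n i)
    (x : ℝ) : (independencePolynomial (starlikeTree n)).eval x =
      starlikeValue Finset.univ n (-x) := by
  classical
  have prod_ite_forall {a : Fin k → ℝ} {p : Fin k → Prop} :
      (if ∀ i, p i then ∏ i, a i else 0) = ∏ i, if p i then a i else 0 := by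
    split_ifs with h
    · exact Finset.prod_congr rfl fun i _ => (if_pos (h i)).symm
    · push Not at h
      obtain ⟨i, hi⟩ := h
      exact (Finset.prod_eq_zero (Finset.mem_univ i) (if_neg hi)).symm
  have key (b : Bool) : (∑ d : (Σ i : Fin k, Fin (n i - 1)) → Bool,
      if ∀ i, PathIndependent b (fun a => d ⟨i, a⟩) then ∏ v, (if d v then x else 1) else 0) =
      ∏ i, ∑ c : Fin (n i - 1) → Bool,
        if PathIndependent b c then ∏ a, (if c a then x else 1) else 0 := by
    rw [Finset.prod_univ_sum, Fintype.piFinset_univ]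
    refine Fintype.sum_equiv (Equiv.piCurry fun _ _ => Bool) _ _ fun d => ?_
    rw [Fintype.prod_sigma, prod_ite_forall]
    rfl
  have split : (independencePolynomial (starlikeTree n)).eval x =
      ∑ b : Bool, (if b then x else 1) * ∑ d : (Σ i : Fin k, Fin (n i - 1)) → Bool,
        if ∀ i, PathIndependent b (fun a => d ⟨i, a⟩) then
          ∏ v, (if d v then x else 1) else 0 := by
    rw [independencePolynomial_eval, ← Equiv.piOptionEquivProd.symm.sum_comp,
      Fintype.sum_prod_type]
    refine Finset.sum_congr rfl fun b _ => ?_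
    simp only [starlikeTree_independent_iff, Fintype.prod_option, Finset.mul_sum, mul_ite, mul_zero]
    rfl
  simp only [split, Fintype.sum_bool, key, sum_pathIndependent]
  have e₁ (i) : n i - 1 + 1 = n i := Nat.sub_add_cancel (hn i)
  have e₂ (i) : n i - 1 + 2 = n i + 1 := by have := hn i; omega
  simp only [starlikeValue, e₁, e₂]
  simp
  ring

/-! ### Extending tuples by zero to sequences on ℕ -/

theorem sum_range_fin_extend {k : ℕ} (n : Fin k → ℕ) (l : ℕ) :
    (∑ i ∈ Finset.range l, if h : i < k then n ⟨i, h⟩ else 0) =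
      ∑ i : Fin k with i.val < l, n i := by
  have h₁ : ∀ i ∈ Finset.range l, (if h : i < k then n ⟨i, h⟩ else 0) =
      ∑ j : Fin k with j.val = i, n j := by
    intro i _
    split_ifs with h
    · rw [Finset.sum_eq_single_of_mem (⟨i, h⟩ : Fin k) (by simp)]
      exact fun j hj hne => absurd (Fin.ext (Finset.mem_filter.1 hj).2) hne
    · refine (Finset.sum_eq_zero fun j hj => absurd j.isLt ?_).symm
      rw [(Finset.mem_filter.1 hj).2]
      exact h
  rw [Finset.sum_congr rfl h₁, ← Finset.sum_fiberwise_of_maps_to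
    (s := Finset.univ.filter fun i : Fin k => i.val < l) (t := Finset.range l)
    (g := fun i : Fin k => i.val) fun i hi => by simpa using hi]
  refine Finset.sum_congr rfl fun i hi => Finset.sum_congr (Finset.ext fun j => ?_) fun _ _ => rfl
  have := Finset.mem_range.1 hi
  simp only [Finset.mem_filter, Finset.mem_univ, true_and]
  omega

theorem antitone_fin_extend {k : ℕ} {n : Fin k → ℕ} (hn : Antitone n) :
    Antitone fun i : ℕ => if h : i < k then n ⟨i, h⟩ else 0 := by
  intro a b hab
  dsimp only
  split_ifs with hb ha ha
  · exact hn (Fin.mk_le_mk.2 hab)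
  · omega
  · exact Nat.zero_le _
  · exact le_rfl

theorem starlikeValue_fin_extend {k : ℕ} (n : Fin k → ℕ) (t : ℝ) :
    starlikeValue (Finset.range k) (fun i => if h : i < k then n ⟨i, h⟩ else 0) t =
      starlikeValue Finset.univ n t := by
  simp only [starlikeValue, Finset.prod_range, Fin.is_lt, dif_pos, Fin.eta]

theorem Dominates.starlikeValue_pos {k : ℕ} {n m : Fin k → ℕ} (hdom : Dominates n m)
    (hn : Antitone n) (hm : Antitone m) (hnpos : ∀ i, 0 < n i) (hmpos : ∀ i, 0 < m i)
    (hsum : ∑ i, m i = ∑ i, n i) {t : ℝ}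
    (h : ∀ u ∈ Set.Icc 0 t, 0 < starlikeValue Finset.univ m u) :
    ∀ u ∈ Set.Icc 0 t, 0 < starlikeValue Finset.univ n u := by
  simp only [← starlikeValue_fin_extend] at h ⊢
  have heq (l : ℕ) (hl : k ≤ l) : (Finset.univ.filter fun i : Fin k => i.val < l) = Finset.univ :=
    Finset.filter_true_of_mem fun i _ => i.isLt.trans_le hl
  refine starlikeValue_pos_of_dominates (antitone_fin_extend hn) (antitone_fin_extend hm)
    (fun i hi => by simpa [hi] using hnpos _) (fun i hi => by simpa [hi] using hmpos _)
    (fun l => ?_) (fun l hl => ?_) h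
  · rw [sum_range_fin_extend, sum_range_fin_extend]
    rcases le_or_gt k l with hl | hl
    · rw [heq l hl, hsum]
    -- `Dominates` indexes a partial sum by its last term, so a sum of `l + 1` terms corresponds to
    -- index `l`.
    rcases l with _ | l
    · simp
    · have e : (Finset.univ.filter fun i : Fin k => i.val < l + 1) =
          Finset.Iic ⟨l, by omega⟩ := by
        ext i
        simp [Fin.le_def]
      rw [e]
      exact hdom _
  · rw [sum_range_fin_extend, sum_range_fin_extend, heq l hl, hsum]

/-! ### Largest roots and the comparison -/

theorem card_starlikeVertex {k : ℕ} {n : Fin k → ℕ} (hn : ∀ i, 0 < n i) :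
    Fintype.card (StarlikeVertex n) + k = ∑ i, n i + 1 := by
  have : ∑ i, (n i - 1) + k = ∑ i, n i := by
    have hk : ∑ _i : Fin k, 1 = k := by simp
    refine (congrArg (∑ i, (n i - 1) + ·) hk.symm).trans ?_
    rw [← Finset.sum_add_distrib]
    exact Finset.sum_congr rfl fun i _ => Nat.sub_add_cancel (hn i)
  simp only [Fintype.card_option, Fintype.card_sigma, Fintype.card_fin]
  omega

theorem isGreatest_xi_of_iso {V : Type*} [Fintype V] {T : SimpleGraph V} {k : ℕ} {n : Fin k → ℕ}
    (hn : ∀ i, 2 ≤ n i) (e : T ≃g starlikeTree n) : IsGreatest (independenceRoots T) (xi T) := by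
  have heval (x : ℝ) : (independencePolynomial T).eval x = starlikeValue Finset.univ n (-x) := by
    rw [independencePolynomial_eval_congr e,
      independencePolynomial_starlikeTree_eval fun i => two_pos.trans_le (hn i)]
  have hne : (independenceRoots T).Nonempty := by
    obtain ⟨t, ht⟩ := exists_starlikeValue_eq_zero Finset.univ fun i _ => hn i
    refine ⟨-t, ?_⟩
    rw [independenceRoots, Set.mem_ofPred_eq, Polynomial.IsRoot.def, heval, neg_neg, ht]
  have h0 : independencePolynomial T ≠ 0 := fun h => by
    have := starlikeValue_pos_of_nonpos Finset.univ (fun i _ => two_pos.trans_le (hn i))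
      (neg_zero (G := ℝ)).le
    rw [← heval, h, Polynomial.eval_zero] at this
    exact this.false
  have hfin : (independenceRoots T).Finite := Polynomial.finite_setOfPred_isRoot h0
  exact ⟨hne.csSup_mem hfin, fun x hx => le_csSup hfin.bddAbove hx⟩

theorem mainTheorem6 {V₁ V₂ : Type*} [Fintype V₁] [Fintype V₂]
    (T₁ : SimpleGraph V₁) (T₂ : SimpleGraph V₂)
    [DecidableRel T₁.Adj] [DecidableRel T₂.Adj]
    (N k : ℕ) (n m : Fin k → ℕ)
    (hn : Antitone n) (hm : Antitone m)
    (hn2 : ∀ i, 2 ≤ n i) (hm2 : ∀ i, 2 ≤ m i)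
    (hT₁ : Nonempty (T₁ ≃g starlikeTree n)) (hT₂ : Nonempty (T₂ ≃g starlikeTree m))
    (hcard₁ : Fintype.card V₁ = N) (hcard₂ : Fintype.card V₂ = N)
    (hdeg₁ : T₁.maxDegree = k) (hdeg₂ : T₂.maxDegree = k)
    (hdom : Dominates n m) :
    IsGreatest (independenceRoots T₁) (xi T₁) ∧
      IsGreatest (independenceRoots T₂) (xi T₂) ∧
      xi T₁ ≤ xi T₂ := by
  obtain ⟨e₁⟩ := hT₁
  obtain ⟨e₂⟩ := hT₂
  have g₁ := isGreatest_xi_of_iso hn2 e₁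
  have g₂ := isGreatest_xi_of_iso hm2 e₂
  refine ⟨g₁, g₂, ?_⟩
  have hnpos (i) : 0 < n i := two_pos.trans_le (hn2 i)
  have hmpos (i) : 0 < m i := two_pos.trans_le (hm2 i)
  have hsum : ∑ i, m i = ∑ i, n i := by
    have := card_starlikeVertex hnpos
    have := card_starlikeVertex hmpos
    rw [← Fintype.card_congr e₁.toEquiv] at *
    have := Fintype.card_congr e₂.toEquiv
    omega
  by_contra! hlt
  have hroot : starlikeValue Finset.univ n (-xi T₁) = 0 := by
    rw [← independencePolynomial_starlikeTree_eval hnpos, ← independencePolynomial_eval_congr e₁]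
    exact g₁.1
  have hpos : 0 ≤ -xi T₁ := by
    by_contra! h
    exact (starlikeValue_pos_of_nonpos Finset.univ (fun i _ => hnpos i) h.le).ne' hroot
  refine (hdom.starlikeValue_pos hn hm hnpos hmpos hsum (fun u hu => ?_) _ ⟨hpos, le_rfl⟩).ne' hroot
  -- A nonpositive value at `u` would give a zero `w ≤ u ≤ -xi T₁`, hence a root `-w ≥ xi T₁` of the
  -- second tree, above its largest root.
  by_contra! hneg
  obtain ⟨w, hw, hw0⟩ := intermediate_value_Icc' hu.1
    (continuous_starlikeValue Finset.univ m).continuousOn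
    ⟨hneg, (starlikeValue_pos_of_nonpos Finset.univ (fun i _ => hmpos i) le_rfl).le⟩
  have hmem : -w ∈ independenceRoots T₂ := by
    rw [independenceRoots, Set.mem_ofPred_eq, Polynomial.IsRoot.def,
      independencePolynomial_eval_congr e₂, independencePolynomial_starlikeTree_eval hmpos,
      neg_neg, hw0]
  linarith [g₂.2 hmem, hw.2, hu.2]
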